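/- Let $\mathbb F=\mathbb Q(q,t)$ with $q,t$ formal parameters, let $N\ge 1$, and let $\Lambda_N\subset\mathbb F[x_1,\dots,x_N]$ be the space of symmetric polynomials. On $\mathbb F(x_1,\dots,x_N)$ let $\gamma_i$ be the operator $(\gamma_i f)(x_1,\dots,x_N)=f(x_1,\dots,q^{-1}x_i,\dots,x_N)$, let $\sigma_{ij}$ be the operator exchanging the variables $x_i$ and $x_j$, and for $i\ne j$ put $$A_{ij}=\frac{x_i-t\,x_j}{x_i-x_j},\qquad B_{ij}=\frac{(t-1)\,x_j}{x_i-x_j}.$$ Let $u$ be a formal variable, and let $D_N(u)$ be the Macdonald determinant, the polynomial in $u$ with operator coefficients $$D_N(u)=\Delta^{-1}\sum_{\sigma\in\mathfrak S_N}(-1)^{\sigma}\prod_{i=1}^N\Bigl(x_i^{\,N-\sigma(i)}\bigl(1+u\,t^{\,\sigma(i)-1}\gamma_i\bigr)\Bigr),\qquad \Delta=\prod_{1\le i<j\le N}(x_i-x_j),$$ so that $D_N(0)=1$. Define operators on $\mathbb F(x_1,\dots,x_N)$ by $Z_i=W_i\gamma_i$ and $U_i$, where $$W_i=\prod_{l\ne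 i}A_{il}+\sum_{j\ne i}B_{ij}\Bigl(\prod_{l\ne i,j}A_{jl}\Bigr)\sigma_{ij},\qquad U_i=(t-1)\Bigl(\prod_{l\ne i}A_{il}\Bigr)\gamma_i .$$ **Theorem (Main identity).** The action of the ratio $D_N(ut)/D_N(u)=D_N(ut)\,D_N(u)^{-1}$ on $\Lambda_N$ coincides with the action of the sum $$1+u\sum_{i=1}^N U_i\,(1+u\,Z_i)^{-1}.$$ Here both sides are expanded as formal power series in $u$ with operator coefficients: for every $n\ge 0$ and every $f\in\Lambda_N$, the coefficients at $u^n$ of the two series take the same value at $f$. -/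

import Mathlib

noncomputable section

namespace CovariantMacdonald

open PowerSeries

/-- The base field `𝔽 = ℚ(q, t)` of rational functions in two formal parameters. -/
abbrev BaseField : Type := FractionRing (MvPolynomial (Fin 2) ℚ)

/-- The formal parameter `q`. -/
def q : BaseField := algebraMap (MvPolynomial (Fin 2) ℚ) BaseField (MvPolynomial.X 0)

/-- The formal parameter `t`. -/
def t : BaseField := algebraMap (MvPolynomial (Fin 2) ℚ) BaseField (MvPolynomial.X 1)

theorem q_ne_zero : q ≠ 0 := by
  unfold q
  rw [Ne, IsFractionRing.to_map_eq_zero_iff]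
  exact MvPolynomial.X_ne_zero 0

/-- The polynomial ring `𝔽[x₁, …, x_N]`; the variables are indexed by `Fin N`, so that the
variable `x_{i+1}` of the usual 1-based numbering is `X i`. -/
abbrev Poly (N : ℕ) : Type := MvPolynomial (Fin N) BaseField

/-- The field `𝔽(x₁, …, x_N)` of rational functions. -/
abbrev RatFun (N : ℕ) : Type := FractionRing (Poly N)

/-- The algebra of `𝔽`-linear operators on `𝔽(x₁, …, x_N)`; its product is composition. -/
abbrev Op (N : ℕ) : Type := Module.End BaseField (RatFun N)

variable {N : ℕ}

/-- The variable `x_i` as a rational function. -/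
def x (i : Fin N) : RatFun N := algebraMap (Poly N) (RatFun N) (MvPolynomial.X i)

/-- The operator of multiplication by a rational function. -/
def mulOp (f : RatFun N) : Op N := LinearMap.mulLeft BaseField f

/-- The operator on rational functions given by an automorphism of the polynomial ring,
that is, by an invertible polynomial substitution of the variables. -/
def substOp (e : Poly N ≃ₐ[BaseField] Poly N) : Op N :=
  (IsFractionRing.algEquivOfAlgEquiv e : RatFun N ≃ₐ[BaseField] RatFun N).toLinearMap

/-- The substitution `x_i ↦ c x_i` that fixes all the other variables. -/
def scaleHom (c : BaseField) (i : Fin N) : Poly N →ₐ[BaseField] Poly N :=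
  MvPolynomial.aeval fun j =>
    if j = i then MvPolynomial.C c * MvPolynomial.X j else MvPolynomial.X j

theorem scaleHom_comp {c d : BaseField} (h : c * d = 1) (i : Fin N) :
    (scaleHom c i).comp (scaleHom d i) = AlgHom.id BaseField (Poly N) := by
  apply MvPolynomial.algHom_ext
  intro j
  by_cases hj : j = i
  · have h1 : MvPolynomial.C (σ := Fin N) d * MvPolynomial.C c = 1 := by
      rw [← MvPolynomial.C_mul, mul_comm, h, MvPolynomial.C_1]
    simp [scaleHom, hj, MvPolynomial.algebraMap_eq, ← mul_assoc, h1]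
  · simp [scaleHom, hj]

/-- The substitution `x_i ↦ q⁻¹ x_i` as an automorphism of the polynomial ring. -/
def shiftEquiv (i : Fin N) : Poly N ≃ₐ[BaseField] Poly N :=
  AlgEquiv.ofAlgHom (scaleHom q⁻¹ i) (scaleHom q i)
    (scaleHom_comp (inv_mul_cancel₀ q_ne_zero) i)
    (scaleHom_comp (mul_inv_cancel₀ q_ne_zero) i)

/-- The inverse `q`-shift operator
`(γ_i f)(x₁, …, x_N) = f(x₁, …, q⁻¹ x_i, …, x_N)`. -/
def γ (i : Fin N) : Op N := substOp (shiftEquiv i)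

/-- The operator `σ_{ij}` exchanging the variables `x_i` and `x_j`. -/
def σ (i j : Fin N) : Op N :=
  substOp (MvPolynomial.renameEquiv BaseField (Equiv.swap i j))

/-- The scalar `t` regarded as a rational function. -/
def tRat (N : ℕ) : RatFun N := algebraMap BaseField (RatFun N) t

/-- `A_{ij} = (x_i - t x_j) / (x_i - x_j)`. -/
def A (i j : Fin N) : RatFun N := (x i - tRat N * x j) / (x i - x j)

/-- `B_{ij} = (t - 1) x_j / (x_i - x_j)`. -/
def B (i j : Fin N) : RatFun N := (tRat N - 1) * x j / (x i - x j)

/-- `W_i = ∏_{l ≠ i} A_{il} + ∑_{j ≠ i} B_{ij} (∏_{l ≠ i, j} A_{jl}) σ_{ij}`. -/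
def W (i : Fin N) : Op N :=
  mulOp (∏ l ∈ Finset.univ.filter (fun l => l ≠ i), A i l) +
    ∑ j ∈ Finset.univ.filter (fun j => j ≠ i),
      mulOp (B i j * ∏ l ∈ Finset.univ.filter (fun l => l ≠ i ∧ l ≠ j), A j l) * σ i j

/-- The covariant operators `Z_i = W_i γ_i`. -/
def Z (i : Fin N) : Op N := W i * γ i

/-- `U_i = (t - 1) (∏_{l ≠ i} A_{il}) γ_i`. -/
def U (i : Fin N) : Op N :=
  mulOp ((tRat N - 1) * ∏ l ∈ Finset.univ.filter (fun l => l ≠ i), A i l) * γ i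

/-- The Vandermonde polynomial `det [x_i ^ (N - j)] = ∏_{i < j} (x_i - x_j)`, with `i, j`
running from `1` to `N` (the exponent is `N - 1 - j` for the 0-based index `j`). -/
def vandermonde (N : ℕ) : RatFun N :=
  (Matrix.of fun i j : Fin N => x i ^ (N - 1 - (j : ℕ))).det

/-- The Macdonald determinant
`D_N(v) = Δ⁻¹ ∑_σ (-1)^σ ∏_i x_i ^ (N - σ(i)) (1 + v t ^ (σ(i) - 1) γ_i)`
evaluated at a formal power series `v` (the case `v = u` being `D_N(u)`, and `v = t u` being
`D_N(u t)`), as a formal power series with operator coefficients.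
In each summand the factors are multiplied from left to right in the order `i = 1, …, N`. -/
def macdonaldD (N : ℕ) (v : (Op N)⟦X⟧) : (Op N)⟦X⟧ :=
  C (mulOp (vandermonde N)⁻¹) *
    ∑ s : Equiv.Perm (Fin N), ((Equiv.Perm.sign s : ℤˣ) : ℤ) •
      (List.ofFn fun i : Fin N =>
        C (mulOp (x i ^ (N - 1 - (s i : ℕ)))) *
          (1 + v * C (mulOp (tRat N ^ (s i : ℕ)) * γ i))).prod

/-- `D_N(u t) / D_N(u)`, that is `D_N(u t) · D_N(u)⁻¹`, as a formal power series in `u` with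
operator coefficients. -/
def macdonaldRatio (N : ℕ) : (Op N)⟦X⟧ :=
  macdonaldD N (t • (X : (Op N)⟦X⟧)) * Ring.inverse (macdonaldD N X)

/-- The series `1 + u ∑_i U_i (1 + u Z_i)⁻¹` in `u` with operator coefficients. -/
def covariantSeries (N : ℕ) : (Op N)⟦X⟧ :=
  1 + X * ∑ i : Fin N, C (U i) * Ring.inverse (1 + X * C (Z i))

/-! ### Sanity facts: the inverses are genuine and the operators act as announced -/

theorem mulOp_apply (f g : RatFun N) : mulOp f g = f * g := rfl

theorem mulOp_mul (f g : RatFun N) : mulOp f * mulOp g = mulOp (f * g) := by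
  ext h; simp [mulOp]

theorem γ_x_self (i : Fin N) : γ i (x i) = algebraMap BaseField (RatFun N) q⁻¹ * x i := by
  simp only [γ, substOp, x, AlgEquiv.toLinearMap_apply,
    IsFractionRing.algEquivOfAlgEquiv_algebraMap]
  simp [shiftEquiv, scaleHom, IsScalarTower.algebraMap_apply BaseField (Poly N) (RatFun N),
    MvPolynomial.algebraMap_eq]

theorem γ_x_of_ne {i j : Fin N} (h : j ≠ i) : γ i (x j) = x j := by
  simp only [γ, substOp, x, AlgEquiv.toLinearMap_apply,
    IsFractionRing.algEquivOfAlgEquiv_algebraMap]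
  simp [shiftEquiv, scaleHom, h]

theorem σ_x (i j k : Fin N) : σ i j (x k) = x (Equiv.swap i j k) := by
  simp only [σ, substOp, x, AlgEquiv.toLinearMap_apply,
    IsFractionRing.algEquivOfAlgEquiv_algebraMap]
  simp

theorem x_injective : Function.Injective (x : Fin N → RatFun N) := fun _ _ h =>
  MvPolynomial.X_injective (IsFractionRing.injective (Poly N) (RatFun N) h)

theorem vandermonde_ne_zero (N : ℕ) : vandermonde N ≠ 0 := by
  have h : (Matrix.vandermonde (fun i : Fin N => x i)).det ≠ 0 :=
    Matrix.det_vandermonde_ne_zero_iff.2 x_injective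
  have h2 : (Matrix.of fun i j : Fin N => x i ^ (N - 1 - (j : ℕ))) =
      (Matrix.vandermonde (fun i : Fin N => x i)).submatrix id Fin.revPerm := by
    ext i j
    have : N - 1 - (j : ℕ) = N - (j + 1) := by omega
    simp [Matrix.vandermonde_apply, Fin.val_rev, this]
  unfold vandermonde
  rw [h2, Matrix.det_permute']
  refine mul_ne_zero ?_ h
  rcases Int.units_eq_one_or (Equiv.Perm.sign (Fin.revPerm (n := N))) with h | h <;> simp [h]

/-- `D_N(0) = 1`. -/
theorem constantCoeff_macdonaldD {v : (Op N)⟦X⟧} (hv : constantCoeff v = 0) :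
    constantCoeff (macdonaldD N v) = 1 := by
  have hl : ∀ l : List (RatFun N), (l.map mulOp).prod = mulOp l.prod := by
    intro l
    induction l with
    | nil => ext; simp [mulOp]
    | cons a l ih => simp [ih, mulOp_mul]
  have h : ∀ s : Equiv.Perm (Fin N),
      constantCoeff (List.ofFn fun i : Fin N =>
        C (mulOp (x i ^ (N - 1 - (s i : ℕ)))) *
          (1 + v * C (mulOp (tRat N ^ (s i : ℕ)) * γ i))).prod =
      mulOp (∏ i, x i ^ (N - 1 - (s i : ℕ))) := by
    intro s
    rw [map_list_prod, List.map_ofFn, ← List.prod_ofFn, ← hl, List.map_ofFn]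
    congr 2
    funext i
    simp [hv]
  have hsum : ∑ s : Equiv.Perm (Fin N), ((Equiv.Perm.sign s : ℤˣ) : ℤ) •
      mulOp (∏ i, x i ^ (N - 1 - (s i : ℕ))) = mulOp (vandermonde N) := by
    rw [vandermonde, ← Matrix.det_transpose, Matrix.det_apply']
    ext g
    simp [mulOp_apply, Finset.sum_mul, mul_assoc]
  rw [macdonaldD, map_mul, map_sum]
  simp only [map_zsmul, h, hsum, constantCoeff_C, mulOp_mul]
  rw [inv_mul_cancel₀ (vandermonde_ne_zero N)]
  ext; simp [mulOp]

theorem isUnit_macdonaldD (N : ℕ) : IsUnit (macdonaldD N X) :=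
  isUnit_iff_constantCoeff.2 (by rw [constantCoeff_macdonaldD (by simp)]; exact isUnit_one)

theorem isUnit_one_add_X_mul_C_Z (i : Fin N) : IsUnit (1 + X * C (Z i) : (Op N)⟦X⟧) :=
  isUnit_iff_constantCoeff.2 (by simp)

end CovariantMacdonald

end

/-!
Write `D(v)` for the Macdonald determinant and `A_{I K} = ∏_{a ∈ I} ∏_{b ∈ K} A_{ab}`. The identity is
proved in the multiplied form `D(ut) = (1 + u ∑ U_i (1 + u Z_i)⁻¹) D(u)` on symmetric rational
functions; it yields the stated one because `D(u)` preserves these functions, hence so does its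
inverse (`PreservesSym.of_mul_eq_one`).

Expanding the determinant over the set `I` of rows in which the shift is taken, every coefficient
is a homogeneous Vandermonde determinant, and
`D(u) = ∑_I u ^ |I| t ^ C(|I|, 2) A_{I Iᶜ} ∏_{i ∈ I} γ_i` (`macdonaldD_smul_X`).

The resolvent `(1 + u Z_i)⁻¹ D(u)` is explicit on symmetric functions: it is `G_i`, the Macdonald
determinant `D(ut)` in the `N - 1` variables other than `x_i`
(`one_add_Z_mul_omitExpansion`). Since `G_i` never shifts `x_i`, no square of a `γ_i` arises in
`Z_i G_i`, and on a symmetric function `σ_{ij}` only changes the set of shifted variables. Thus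
both `(1 + u Z_i) G_i = D(u)` and `D(ut) = D(u) + u ∑ U_i G_i` (`macdonaldExpansion_tRat`) amount to
an identity of rational functions for each subset `I`. All of these are specialisations of one
partial fraction expansion in `z`, `prod_sub_mul_div_add_sum`, at `z = x_i` (for `i ∈ I`),
at `z = t x_i` (for `i ∉ I`) and at `z = 0` (for the sum over `U_i`).
-/

/-! ### Partial fractions -/

section PartialFractions

variable {ι K : Type*} [DecidableEq ι] [Field K]

/-- Partial fractions in `z`, obtained by Lagrange interpolation at the nodes `v j` of
`∏ (z - v l) - ∏ (z - τ v l)`, whose degree is less than the number of nodes. -/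
theorem prod_sub_mul_div_add_sum (s : Finset ι) (v : ι → K) (hv : Set.InjOn v s) (τ z : K)
    (hz : ∀ i ∈ s, z ≠ v i) :
    ∏ l ∈ s, (z - τ * v l) / (z - v l) +
      ∑ j ∈ s, (τ - 1) * v j / (z - v j) *
        ∏ l ∈ s.erase j, (v j - τ * v l) / (v j - v l) = 1 := by
  set P : Polynomial K := Lagrange.nodal s v - Lagrange.nodal s (fun l => τ * v l) with hP
  have hdeg : P.degree < s.card := by
    have h1 := Lagrange.degree_nodal (s := s) (v := v)
    have h2 := Lagrange.degree_nodal (s := s) (v := fun l => τ * v l)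
    rw [← h1]
    refine Polynomial.degree_sub_lt_left (h1.trans h2.symm) Lagrange.nodal_ne_zero ?_
    rw [Lagrange.nodal_monic.leadingCoeff, Lagrange.nodal_monic.leadingCoeff]
  have hne : ∏ l ∈ s, (z - v l) ≠ 0 :=
    Finset.prod_ne_zero_iff.2 fun l hl => sub_ne_zero.2 (hz l hl)
  have key := congrArg (Polynomial.eval z) (Lagrange.eq_interpolate hv hdeg)
  rw [Lagrange.eval_interpolate_not_at_node _ hz, hP] at key
  simp only [Polynomial.eval_sub, Lagrange.eval_nodal] at key
  have hsum : ∑ j ∈ s, (τ - 1) * v j / (z - v j) *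
        ∏ l ∈ s.erase j, (v j - τ * v l) / (v j - v l) =
      ∑ i ∈ s, Lagrange.nodalWeight s v i * (z - v i)⁻¹ *
        (∏ l ∈ s, (v i - v l) - ∏ l ∈ s, (v i - τ * v l)) := by
    refine Finset.sum_congr rfl fun j hj => ?_
    rw [Finset.prod_eq_zero hj (sub_self (v j)), ← Finset.mul_prod_erase s _ hj,
      Lagrange.nodalWeight, Finset.prod_div_distrib, Finset.prod_inv_distrib]
    ring
  rw [hsum, Finset.prod_div_distrib, div_add' _ _ _ hne, div_eq_one_iff_eq hne]
  linear_combination -key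

end PartialFractions

namespace CovariantMacdonald

noncomputable section

open PowerSeries

variable {N : ℕ}

theorem x_sub_ne_zero {i j : Fin N} (h : i ≠ j) : x i - x j ≠ 0 :=
  sub_ne_zero.2 (x_injective.ne h)

theorem x_ne_zero (i : Fin N) : x i ≠ 0 := by
  unfold x
  rw [Ne, IsFractionRing.to_map_eq_zero_iff]
  exact MvPolynomial.X_ne_zero i

theorem tRat_mul_x_ne (i j : Fin N) (h : i ≠ j) : tRat N * x i ≠ x j := by
  intro H
  have H2 : (algebraMap (Poly N) (RatFun N)) (MvPolynomial.C t * MvPolynomial.X i) =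
      algebraMap (Poly N) (RatFun N) (MvPolynomial.X j) := by
    rw [map_mul]
    exact H
  have H3 := congrArg (MvPolynomial.coeff (Finsupp.single j 1))
    (IsFractionRing.injective (Poly N) (RatFun N) H2)
  rw [MvPolynomial.coeff_C_mul, MvPolynomial.coeff_X, MvPolynomial.coeff_X,
    if_neg (by simpa [Finsupp.single_left_inj] using h)] at H3
  simp at H3

/-- The partial fraction expansion at `z = x_i`. -/
theorem prod_A_add_sum_B (i : Fin N) (s : Finset (Fin N)) (hi : i ∉ s) :
    ∏ l ∈ s, A i l + ∑ j ∈ s, B i j * ∏ l ∈ s.erase j, A j l = 1 :=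
  prod_sub_mul_div_add_sum s x x_injective.injOn (tRat N) (x i)
    fun _ hj => x_injective.ne fun h => hi (h ▸ hj)

/-- The partial fraction expansion at `z = 0`. -/
theorem tRat_sub_one_mul_sum_prod_A (s : Finset (Fin N)) :
    (tRat N - 1) * ∑ j ∈ s, ∏ l ∈ s.erase j, A j l = tRat N ^ s.card - 1 := by
  have h := prod_sub_mul_div_add_sum s x x_injective.injOn (tRat N) 0
    fun j _ => (x_ne_zero j).symm
  have h1 : ∏ l ∈ s, (0 - tRat N * x l) / (0 - x l) = tRat N ^ s.card := by
    rw [← Finset.prod_const]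
    refine Finset.prod_congr rfl fun l _ => ?_
    have := x_ne_zero l
    rw [zero_sub, zero_sub]
    field_simp
  have h2 : ∀ j ∈ s, (tRat N - 1) * x j / (0 - x j) *
      ∏ l ∈ s.erase j, (x j - tRat N * x l) / (x j - x l) =
        -(tRat N - 1) * ∏ l ∈ s.erase j, A j l := by
    intro j _
    have := x_ne_zero j
    simp only [A]
    rw [zero_sub, mul_div_assoc, div_neg, div_self this]
    ring
  rw [h1, Finset.sum_congr rfl h2, ← Finset.mul_sum] at h
  linear_combination -h

/-- The partial fraction expansion at `z = t x_i`, multiplied by `∏ A_{ai}`. -/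
theorem prod_A_eq_pow_add_sum_B (i : Fin N) (s : Finset (Fin N)) (hi : i ∉ s) :
    ∏ a ∈ s, A a i = tRat N ^ s.card +
      ∑ j ∈ s, B i j * (∏ l ∈ s.erase j, A j l) * ∏ a ∈ s.erase j, A a i := by
  have hne : ∀ j ∈ s, j ≠ i := fun j hj h => hi (h ▸ hj)
  have h := prod_sub_mul_div_add_sum s x x_injective.injOn (tRat N) (tRat N * x i)
    fun j hj => tRat_mul_x_ne i j (hne j hj).symm
  have hA : ∀ j ∈ s, x j - tRat N * x i ≠ 0 := fun j hj =>
    sub_ne_zero.2 (tRat_mul_x_ne i j (hne j hj).symm).symm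
  have h1 : (∏ l ∈ s, (tRat N * x i - tRat N * x l) / (tRat N * x i - x l)) * ∏ a ∈ s, A a i =
      tRat N ^ s.card := by
    rw [← Finset.prod_const, ← Finset.prod_mul_distrib]
    refine Finset.prod_congr rfl fun l hl => ?_
    have h3 := hA l hl
    have h4 : tRat N * x i - x l ≠ 0 := by rw [← neg_sub]; exact neg_ne_zero.2 h3
    have h5 := x_sub_ne_zero (hne l hl)
    simp only [A]
    field_simp
    ring
  have h2 : ∀ j ∈ s, (tRat N - 1) * x j / (tRat N * x i - x j) *
      (∏ l ∈ s.erase j, (x j - tRat N * x l) / (x j - x l)) * ∏ a ∈ s, A a i =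
        B i j * (∏ l ∈ s.erase j, A j l) * ∏ a ∈ s.erase j, A a i := by
    intro j hj
    have h3 := hA j hj
    have h4 : tRat N * x i - x j ≠ 0 := by rw [← neg_sub]; exact neg_ne_zero.2 h3
    have h5 := x_sub_ne_zero (hne j hj)
    have h6 := x_sub_ne_zero (hne j hj).symm
    have h7 : (tRat N - 1) * x j / (tRat N * x i - x j) * A j i = B i j := by
      simp only [A, B]
      field_simp
      ring
    rw [← Finset.mul_prod_erase s _ hj, ← h7]
    simp only [A]
    ring
  have h8 := congrArg (· * ∏ a ∈ s, A a i) h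
  simp only [add_mul, Finset.sum_mul, one_mul] at h8
  rw [h1, Finset.sum_congr rfl h2] at h8
  exact h8.symm

/-! ### Shifts and permutations as field automorphisms -/

theorem RatFun.algHom_ext {φ ψ : RatFun N →ₐ[BaseField] RatFun N} (h : ∀ j, φ (x j) = ψ (x j)) :
    φ = ψ := by
  refine IsLocalization.algHom_ext (A := Poly N) (nonZeroDivisors (Poly N)) ?_
  refine MvPolynomial.algHom_ext fun j => ?_
  exact h j

theorem scale_comp_scale {c d : Fin N → BaseField} (h : ∀ i, c i * d i = 1) :
    (MvPolynomial.aeval (fun j => MvPolynomial.C (c j) * MvPolynomial.X j) :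
      Poly N →ₐ[BaseField] Poly N).comp
      (MvPolynomial.aeval fun j => MvPolynomial.C (d j) * MvPolynomial.X j) =
      AlgHom.id BaseField (Poly N) := by
  apply MvPolynomial.algHom_ext
  intro j
  have h1 : MvPolynomial.C (σ := Fin N) (d j) * MvPolynomial.C (c j) = 1 := by
    rw [← MvPolynomial.C_mul, mul_comm, h, MvPolynomial.C_1]
  simp [MvPolynomial.algebraMap_eq, ← mul_assoc, h1]

/-- The substitution `x_i ↦ q⁻¹ x_i` for all `i ∈ s` at once. -/
def multiShiftEquiv (s : Finset (Fin N)) : Poly N ≃ₐ[BaseField] Poly N :=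
  AlgEquiv.ofAlgHom
    (MvPolynomial.aeval fun j => MvPolynomial.C (if j ∈ s then q⁻¹ else 1) * MvPolynomial.X j)
    (MvPolynomial.aeval fun j => MvPolynomial.C (if j ∈ s then q else 1) * MvPolynomial.X j)
    (scale_comp_scale fun i => by split_ifs <;> simp [q_ne_zero])
    (scale_comp_scale fun i => by split_ifs <;> simp [q_ne_zero])

/-- The product of the commuting operators `γ i` over `i ∈ s`. -/
def Γ (s : Finset (Fin N)) : Op N := substOp (multiShiftEquiv s)

theorem Γ_x (s : Finset (Fin N)) (j : Fin N) :
    Γ s (x j) = algebraMap BaseField (RatFun N) (if j ∈ s then q⁻¹ else 1) * x j := by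
  simp only [Γ, substOp, x, AlgEquiv.toLinearMap_apply,
    IsFractionRing.algEquivOfAlgEquiv_algebraMap]
  simp [multiShiftEquiv, IsScalarTower.algebraMap_apply BaseField (Poly N) (RatFun N),
    MvPolynomial.algebraMap_eq]

/-- An operator given by a substitution, as an algebra endomorphism of the rational functions. -/
def substHom (e : Poly N ≃ₐ[BaseField] Poly N) : RatFun N →ₐ[BaseField] RatFun N :=
  (IsFractionRing.algEquivOfAlgEquiv e : RatFun N ≃ₐ[BaseField] RatFun N).toAlgHom

theorem substOp_apply (e : Poly N ≃ₐ[BaseField] Poly N) (g : RatFun N) :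
    substOp e g = substHom e g := rfl

theorem substOp_mul (e : Poly N ≃ₐ[BaseField] Poly N) (f g : RatFun N) :
    substOp e (f * g) = substOp e f * substOp e g :=
  map_mul (substHom e) f g

theorem γ_Γ {i : Fin N} {s : Finset (Fin N)} (hi : i ∉ s) : γ i * Γ s = Γ (insert i s) := by
  have h : (substHom (shiftEquiv i)).comp (substHom (multiShiftEquiv s)) =
      substHom (multiShiftEquiv (insert i s)) := by
    refine RatFun.algHom_ext fun j => ?_
    change γ i (Γ s (x j)) = Γ (insert i s) (x j)
    rw [Γ_x, Γ_x, γ, substOp_mul, substOp_apply, AlgHom.commutes, ← γ]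
    by_cases hj : j = i
    · subst hj
      simp [γ_x_self, hi]
    · simp [γ_x_of_ne hj, hj]
  ext g
  exact DFunLike.congr_fun h g

theorem σ_Γ (i j : Fin N) (s : Finset (Fin N)) :
    σ i j * Γ s = Γ (s.map (Equiv.swap i j).toEmbedding) * σ i j := by
  have h : (substHom (MvPolynomial.renameEquiv BaseField (Equiv.swap i j))).comp
      (substHom (multiShiftEquiv s)) =
      (substHom (multiShiftEquiv (s.map (Equiv.swap i j).toEmbedding))).comp
        (substHom (MvPolynomial.renameEquiv BaseField (Equiv.swap i j))) := by
    refine RatFun.algHom_ext fun k => ?_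
    change σ i j (Γ s (x k)) = Γ _ (σ i j (x k))
    rw [σ_x, Γ_x, Γ_x, σ, substOp_mul, substOp_apply, AlgHom.commutes, ← σ, σ_x]
    simp
  ext g
  exact DFunLike.congr_fun h g

theorem γ_A {i a b : Fin N} (ha : a ≠ i) (hb : b ≠ i) : γ i (A a b) = A a b := by
  have h1 := γ_x_of_ne ha
  have h2 := γ_x_of_ne hb
  simp only [γ, substOp_apply] at h1 h2 ⊢
  simp only [A, tRat, map_div₀, map_sub, map_mul, AlgHom.commutes, h1, h2]

theorem σ_A (i j a b : Fin N) :
    σ i j (A a b) = A (Equiv.swap i j a) (Equiv.swap i j b) := by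
  have h1 := σ_x i j a
  have h2 := σ_x i j b
  simp only [σ, substOp_apply] at h1 h2 ⊢
  simp only [A, tRat, map_div₀, map_sub, map_mul, AlgHom.commutes, h1, h2]

/-- `A_{I K} = ∏_{a ∈ I} ∏_{b ∈ K} A_{ab}`. -/
def prodA (s r : Finset (Fin N)) : RatFun N := ∏ a ∈ s, ∏ b ∈ r, A a b

theorem γ_tRat_pow_mul_prodA {i : Fin N} {s r : Finset (Fin N)} (hs : i ∉ s) (hr : i ∉ r) (k : ℕ) :
    γ i (tRat N ^ k * prodA s r) = tRat N ^ k * prodA s r := by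
  have h : ∀ a ∈ s, ∀ b ∈ r, substHom (shiftEquiv i) (A a b) = A a b := fun a ha b hb =>
    γ_A (fun h => hs (h ▸ ha)) (fun h => hr (h ▸ hb))
  rw [γ, substOp_apply]
  simp only [prodA, tRat, map_mul, map_pow, AlgHom.commutes, map_prod]
  congr 1
  exact Finset.prod_congr rfl fun a ha => Finset.prod_congr rfl fun b hb => h a ha b hb

theorem σ_tRat_pow_mul_prodA (i j : Fin N) (s r : Finset (Fin N)) (k : ℕ) :
    σ i j (tRat N ^ k * prodA s r) = tRat N ^ k *
      prodA (s.map (Equiv.swap i j).toEmbedding) (r.map (Equiv.swap i j).toEmbedding) := by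
  have h : ∀ a b, substHom (MvPolynomial.renameEquiv BaseField (Equiv.swap i j)) (A a b) =
      A (Equiv.swap i j a) (Equiv.swap i j b) := σ_A i j
  rw [σ, substOp_apply]
  simp only [prodA, tRat, map_mul, map_pow, AlgHom.commutes, map_prod, Finset.prod_map, h]
  rfl

/-! ### Coefficients of the expansions over subsets -/

/-- The coefficient of `∏_{i ∈ s} γ_i` in the Macdonald operator of order `|s|`. -/
def macdonaldCoeff (s : Finset (Fin N)) : RatFun N := tRat N ^ s.card.choose 2 * prodA s sᶜ

/-- The coefficient of `u ^ |s| ∏_{a ∈ s} γ_a`, for `i ∉ s`, in the Macdonald determinant `D(ut)`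
in the `N - 1` variables other than `x_i`. -/
def omitCoeff (i : Fin N) (s : Finset (Fin N)) : RatFun N :=
  tRat N ^ (s.card + 1).choose 2 * prodA s (insert i s)ᶜ

theorem prod_filter_ne (i : Fin N) {s : Finset (Fin N)} (hi : i ∈ s) (f : Fin N → RatFun N) :
    ∏ l ∈ Finset.univ.filter (fun l => l ≠ i), f l = (∏ l ∈ s.erase i, f l) * ∏ l ∈ sᶜ, f l := by
  rw [← Finset.prod_union (Finset.disjoint_left.2 fun a ha hb =>
    Finset.mem_compl.1 hb (Finset.mem_of_mem_erase ha))]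
  refine Finset.prod_congr ?_ fun _ _ => rfl
  ext l
  by_cases h : l = i <;> by_cases h' : l ∈ s <;> simp_all

theorem prod_filter_ne_ne {i j : Fin N} {s : Finset (Fin N)} (hi : i ∉ s) (hj : j ∈ s)
    (f : Fin N → RatFun N) :
    ∏ l ∈ Finset.univ.filter (fun l => l ≠ i ∧ l ≠ j), f l =
      (∏ l ∈ s.erase j, f l) * ∏ l ∈ (insert i s)ᶜ, f l := by
  rw [← Finset.prod_union (Finset.disjoint_left.2 fun a ha hb =>
    Finset.mem_compl.1 hb (Finset.mem_insert_of_mem (Finset.mem_of_mem_erase ha)))]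
  refine Finset.prod_congr ?_ fun _ _ => rfl
  ext l
  by_cases h : l = i <;> by_cases h' : l ∈ s <;> by_cases h'' : l = j <;> simp_all

theorem prodA_erase_mul {j : Fin N} {s : Finset (Fin N)} (hj : j ∈ s) (r : Finset (Fin N)) :
    (∏ l ∈ r, A j l) * prodA (s.erase j) r = prodA s r :=
  Finset.mul_prod_erase s (fun a => ∏ b ∈ r, A a b) hj

theorem prodA_compl {i : Fin N} {s : Finset (Fin N)} (hi : i ∉ s) (r : Finset (Fin N)) :
    prodA r sᶜ = (∏ a ∈ r, A a i) * prodA r (insert i s)ᶜ := by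
  have h : sᶜ = insert i (insert i s)ᶜ := by
    ext l
    by_cases h : l = i <;> simp_all
  rw [h, prodA, prodA, ← Finset.prod_mul_distrib]
  exact Finset.prod_congr rfl fun a _ => Finset.prod_insert (by simp)

theorem card_erase_add_one_choose {j : Fin N} {s : Finset (Fin N)} (hj : j ∈ s) :
    ((s.erase j).card + 1).choose 2 = s.card.choose 2 := by
  rw [Finset.card_erase_add_one hj]

theorem insert_erase_compl {j : Fin N} {s : Finset (Fin N)} (hj : j ∈ s) :
    (insert j (s.erase j))ᶜ = sᶜ := by
  rw [Finset.insert_erase hj]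

/-- The coefficient comparison behind `(1 + u Z_i) G_i = D(u)`, at subsets not containing `i`. -/
theorem omitCoeff_add_sum {i : Fin N} {s : Finset (Fin N)} (hi : i ∉ s) :
    omitCoeff i s + ∑ j ∈ s,
      B i j * (∏ l ∈ Finset.univ.filter (fun l => l ≠ i ∧ l ≠ j), A j l) *
        omitCoeff j (s.erase j) = macdonaldCoeff s := by
  have h : ∀ j ∈ s, B i j * (∏ l ∈ Finset.univ.filter (fun l => l ≠ i ∧ l ≠ j), A j l) *
        omitCoeff j (s.erase j) = tRat N ^ s.card.choose 2 * prodA s (insert i s)ᶜ *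
        (B i j * (∏ l ∈ s.erase j, A j l) * ∏ a ∈ s.erase j, A a i) := by
    intro j hj
    rw [omitCoeff, card_erase_add_one_choose hj, insert_erase_compl hj, prod_filter_ne_ne hi hj,
      prodA_compl hi, ← prodA_erase_mul hj]
    ring
  rw [Finset.sum_congr rfl h, ← Finset.mul_sum, macdonaldCoeff, prodA_compl hi,
    prod_A_eq_pow_add_sum_B i s hi, omitCoeff, Nat.choose_succ_succ' s.card 1, Nat.choose_one_right,
    pow_add]
  ring

/-- The coefficient comparison behind `(1 + u Z_i) G_i = D(u)`, at subsets containing `i`. -/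
theorem macdonaldCoeff_insert {i : Fin N} {s : Finset (Fin N)} (hi : i ∉ s) :
    (∏ l ∈ Finset.univ.filter (fun l => l ≠ i), A i l) * omitCoeff i s +
      ∑ j ∈ s, B i j * (∏ l ∈ Finset.univ.filter (fun l => l ≠ i ∧ l ≠ j), A j l) *
        (tRat N ^ (s.card + 1).choose 2 * prodA ((insert i s).erase j) (insert i s)ᶜ) =
      macdonaldCoeff (insert i s) := by
  have h : ∀ j ∈ s, B i j * (∏ l ∈ Finset.univ.filter (fun l => l ≠ i ∧ l ≠ j), A j l) *
        (tRat N ^ (s.card + 1).choose 2 * prodA ((insert i s).erase j) (insert i s)ᶜ) =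
        macdonaldCoeff (insert i s) * (B i j * (∏ l ∈ s.erase j, A j l)) := by
    intro j hj
    rw [prod_filter_ne_ne hi hj, macdonaldCoeff, Finset.card_insert_of_notMem hi,
      ← prodA_erase_mul (Finset.mem_insert_of_mem hj)]
    ring
  have h2 : (∏ l ∈ Finset.univ.filter (fun l => l ≠ i), A i l) * omitCoeff i s =
      macdonaldCoeff (insert i s) * ∏ l ∈ s, A i l := by
    rw [prod_filter_ne i (Finset.mem_insert_self i s), macdonaldCoeff, omitCoeff,
      ← prodA_erase_mul (Finset.mem_insert_self i s), Finset.erase_insert hi,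
      Finset.card_insert_of_notMem hi]
    ring
  rw [Finset.sum_congr rfl h, h2, ← Finset.mul_sum, ← mul_add, prod_A_add_sum_B i s hi, mul_one]

/-- The coefficient comparison behind `D(ut) = D(u) + u ∑ U_i G_i`. -/
theorem sum_U_coeff (s : Finset (Fin N)) :
    ∑ i ∈ s, (tRat N - 1) * (∏ l ∈ Finset.univ.filter (fun l => l ≠ i), A i l) *
      omitCoeff i (s.erase i) = (tRat N ^ s.card - 1) * macdonaldCoeff s := by
  rw [← tRat_sub_one_mul_sum_prod_A, Finset.mul_sum, Finset.sum_mul]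
  refine Finset.sum_congr rfl fun i hi => ?_
  rw [omitCoeff, card_erase_add_one_choose hi, insert_erase_compl hi, prod_filter_ne i hi,
    macdonaldCoeff, ← prodA_erase_mul hi]
  ring

/-! ### Action on symmetric rational functions -/

/-- The symmetric rational functions. -/
def symRatFun (N : ℕ) : Submodule BaseField (RatFun N) where
  carrier := {g | ∀ i j, σ i j g = g}
  add_mem' ha hb i j := by rw [map_add, ha, hb]
  zero_mem' i j := map_zero _
  smul_mem' c g hg i j := by rw [map_smul, hg]

theorem σ_Γ_apply {g : RatFun N} (hg : g ∈ symRatFun N) (i j : Fin N) (s : Finset (Fin N)) :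
    σ i j (Γ s g) = Γ (s.map (Equiv.swap i j).toEmbedding) g := by
  have h := LinearMap.congr_fun (σ_Γ i j s) g
  simp only [Module.End.mul_apply] at h
  rw [h, hg i j]

theorem γ_Γ_apply {i : Fin N} {s : Finset (Fin N)} (hi : i ∉ s) (g : RatFun N) :
    γ i (Γ s g) = Γ (insert i s) g :=
  LinearMap.congr_fun (γ_Γ hi) g

theorem map_compl_swap (i j : Fin N) (s : Finset (Fin N)) :
    (sᶜ).map (Equiv.swap i j).toEmbedding = (s.map (Equiv.swap i j).toEmbedding)ᶜ := by
  ext l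
  simp [Finset.mem_map_equiv]

theorem map_swap_insert {i j : Fin N} {s : Finset (Fin N)} (hi : i ∉ s) (hj : j ∉ s) :
    (insert i s).map (Equiv.swap i j).toEmbedding = insert j s := by
  ext l
  rw [Finset.mem_map_equiv, Equiv.symm_swap]
  rcases eq_or_ne l i with rfl | h1
  · rcases eq_or_ne l j with rfl | h2 <;> simp_all [eq_comm]
  · rcases eq_or_ne l j with rfl | h2
    · simp
    · simp [Equiv.swap_apply_of_ne_of_ne h1 h2, h1, h2]

theorem map_swap_of_notMem {i j : Fin N} {s : Finset (Fin N)} (hi : i ∉ s) (hj : j ∉ s) :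
    s.map (Equiv.swap i j).toEmbedding = s := by
  ext l
  rw [Finset.mem_map_equiv, Equiv.symm_swap]
  rcases eq_or_ne l i with rfl | h1
  · simp_all
  · rcases eq_or_ne l j with rfl | h2
    · simp_all
    · simp [Equiv.swap_apply_of_ne_of_ne h1 h2]

theorem map_swap_of_mem {i j : Fin N} {s : Finset (Fin N)} (hi : i ∈ s) (hj : j ∈ s) :
    s.map (Equiv.swap i j).toEmbedding = s := by
  ext l
  rw [Finset.mem_map_equiv, Equiv.symm_swap]
  rcases eq_or_ne l i with rfl | h1
  · simp_all
  · rcases eq_or_ne l j with rfl | h2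
    · simp_all
    · simp [Equiv.swap_apply_of_ne_of_ne h1 h2]

theorem map_swap_eq_insert_erase {i j : Fin N} {s : Finset (Fin N)} (hi : i ∉ s) (hj : j ∈ s) :
    s.map (Equiv.swap i j).toEmbedding = (insert i s).erase j := by
  have hij : i ≠ j := fun h => hi (h ▸ hj)
  ext l
  rw [Finset.mem_map_equiv, Equiv.symm_swap]
  rcases eq_or_ne l i with rfl | h1
  · simp_all
  · rcases eq_or_ne l j with rfl | h2
    · simp_all
    · simp [Equiv.swap_apply_of_ne_of_ne h1 h2, h1, h2]

theorem γ_mul (i : Fin N) (f g : RatFun N) : γ i (f * g) = γ i f * γ i g := substOp_mul _ f g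

theorem σ_mul (i j : Fin N) (f g : RatFun N) : σ i j (f * g) = σ i j f * σ i j g :=
  substOp_mul _ f g

theorem γ_omitCoeff_mul {i : Fin N} {s : Finset (Fin N)} (hi : i ∉ s) (g : RatFun N) :
    γ i (omitCoeff i s * Γ s g) = omitCoeff i s * Γ (insert i s) g := by
  rw [γ_mul, γ_Γ_apply hi, omitCoeff, γ_tRat_pow_mul_prodA hi (by simp)]

theorem W_apply (i : Fin N) (h : RatFun N) :
    W i h = (∏ l ∈ Finset.univ.filter (fun l => l ≠ i), A i l) * h +
      ∑ j ∈ Finset.univ.filter (fun j => j ≠ i),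
        B i j * (∏ l ∈ Finset.univ.filter (fun l => l ≠ i ∧ l ≠ j), A j l) * σ i j h := by
  simp only [W, LinearMap.add_apply, LinearMap.sum_apply, Module.End.mul_apply, mulOp_apply]

/-- The action of `Z_i` on a term of `G_i`: the terms of `W_i` without exchange and those exchanging
`x_i` with a shifted variable both give the shift over `s ∪ {i}`; exchanging `x_i` with an unshifted
`x_j` gives the shift over `s ∪ {j}`. -/
theorem Z_omitCoeff {i : Fin N} {s : Finset (Fin N)} (hi : i ∉ s) {g : RatFun N}
    (hg : g ∈ symRatFun N) :
    Z i (omitCoeff i s * Γ s g) = macdonaldCoeff (insert i s) * Γ (insert i s) g +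
      ∑ j ∈ (insert i s)ᶜ,
        B i j * (∏ l ∈ Finset.univ.filter (fun l => l ≠ i ∧ l ≠ j), A j l) * omitCoeff j s *
          Γ (insert j s) g := by
  have hfilter : Finset.univ.filter (fun j => j ≠ i) = s ∪ (insert i s)ᶜ := by
    ext l
    by_cases h : l = i <;> by_cases h' : l ∈ s <;> simp_all
  have hdisj : Disjoint s (insert i s)ᶜ := Finset.disjoint_left.2 fun a ha hb =>
    Finset.mem_compl.1 hb (Finset.mem_insert_of_mem ha)
  have hsum : ∀ F : Fin N → RatFun N, ∑ j ∈ Finset.univ.filter (fun j => j ≠ i), F j =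
      ∑ j ∈ s, F j + ∑ j ∈ (insert i s)ᶜ, F j := fun F => by
    rw [hfilter, Finset.sum_union hdisj]
  have hin : ∀ j ∈ s, σ i j (omitCoeff i s * Γ (insert i s) g) =
      tRat N ^ (s.card + 1).choose 2 * prodA ((insert i s).erase j) (insert i s)ᶜ *
        Γ (insert i s) g := by
    intro j hj
    rw [σ_mul, σ_Γ_apply hg, omitCoeff, σ_tRat_pow_mul_prodA, map_compl_swap,
      map_swap_of_mem (Finset.mem_insert_self i s) (Finset.mem_insert_of_mem hj),
      map_swap_eq_insert_erase hi hj]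
  have hout : ∀ j ∈ (insert i s)ᶜ, σ i j (omitCoeff i s * Γ (insert i s) g) =
      omitCoeff j s * Γ (insert j s) g := by
    intro j hj
    have hj' : j ∉ s := fun h => Finset.mem_compl.1 hj (Finset.mem_insert_of_mem h)
    rw [σ_mul, σ_Γ_apply hg, omitCoeff, σ_tRat_pow_mul_prodA, map_compl_swap,
      map_swap_insert hi hj', map_swap_of_notMem hi hj', omitCoeff]
  rw [Z, Module.End.mul_apply, γ_omitCoeff_mul hi, W_apply, hsum,
    ← macdonaldCoeff_insert hi, add_mul, Finset.sum_mul, add_assoc]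
  rw [Finset.sum_congr rfl fun j hj => by rw [hin j hj],
    Finset.sum_congr (s₁ := (insert i s)ᶜ) rfl fun j hj => by rw [hout j hj]]
  simp only [mul_assoc]

theorem U_omitCoeff {i : Fin N} {s : Finset (Fin N)} (hi : i ∉ s) (g : RatFun N) :
    U i (omitCoeff i s * Γ s g) =
      (tRat N - 1) * (∏ l ∈ Finset.univ.filter (fun l => l ≠ i), A i l) * omitCoeff i s *
        Γ (insert i s) g := by
  rw [U, Module.End.mul_apply, γ_omitCoeff_mul hi, mulOp_apply, mul_assoc _ (omitCoeff i s)]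

/-! ### Operator series on symmetric rational functions -/

/-- Coefficientwise evaluation of a series of operators at a rational function. -/
def evalAt (g : RatFun N) : (Op N)⟦X⟧ →+ (RatFun N)⟦X⟧ where
  toFun P := PowerSeries.mk fun n => coeff n P g
  map_zero' := by ext n; simp
  map_add' P Q := by ext n; simp

theorem coeff_evalAt (g : RatFun N) (P : (Op N)⟦X⟧) (n : ℕ) :
    coeff n (evalAt g P) = coeff n P g :=
  coeff_mk n fun n => coeff n P g

theorem evalAt_monomial (g : RatFun N) (k : ℕ) (a : Op N) :
    evalAt g (monomial k a) = monomial k (a g) := by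
  ext n
  rw [coeff_evalAt, coeff_monomial, coeff_monomial]
  split_ifs <;> simp

/-- Two series of operators that agree on symmetric rational functions. -/
def EqOnSym (P Q : (Op N)⟦X⟧) : Prop := ∀ g ∈ symRatFun N, evalAt g P = evalAt g Q

/-- A series of operators whose coefficients preserve symmetry. -/
def PreservesSym (P : (Op N)⟦X⟧) : Prop := ∀ g ∈ symRatFun N, ∀ n, coeff n P g ∈ symRatFun N

theorem EqOnSym.coeff_eq {P Q : (Op N)⟦X⟧} (h : EqOnSym P Q) {g : RatFun N}
    (hg : g ∈ symRatFun N) (n : ℕ) : coeff n P g = coeff n Q g := by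
  rw [← coeff_evalAt, h g hg, coeff_evalAt]

theorem EqOnSym.mul_left {P Q : (Op N)⟦X⟧} (h : EqOnSym P Q) (R : (Op N)⟦X⟧) :
    EqOnSym (R * P) (R * Q) := by
  intro g hg
  ext n
  rw [coeff_evalAt, coeff_evalAt, coeff_mul, coeff_mul, LinearMap.sum_apply, LinearMap.sum_apply]
  refine Finset.sum_congr rfl fun p _ => ?_
  rw [Module.End.mul_apply, Module.End.mul_apply, h.coeff_eq hg]

theorem EqOnSym.mul_right {P Q R : (Op N)⟦X⟧} (h : EqOnSym P Q) (hR : PreservesSym R) :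
    EqOnSym (P * R) (Q * R) := by
  intro g hg
  ext n
  rw [coeff_evalAt, coeff_evalAt, coeff_mul, coeff_mul, LinearMap.sum_apply, LinearMap.sum_apply]
  refine Finset.sum_congr rfl fun p _ => ?_
  rw [Module.End.mul_apply, Module.End.mul_apply, h.coeff_eq (hR g hg _)]

theorem PreservesSym.of_mul_eq_one {P Q : (Op N)⟦X⟧} (hP : PreservesSym P)
    (h0 : constantCoeff P = 1) (h : P * Q = 1) : PreservesSym Q := by
  intro g hg n
  induction n using Nat.strong_induction_on with
  | _ n ih =>
    have h1 := congrArg (fun a : Op N => a g) (congrArg (coeff n) h)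
    simp only [coeff_mul, LinearMap.sum_apply, Module.End.mul_apply] at h1
    rw [← Finset.add_sum_erase _ _
        (show ((0, n) : ℕ × ℕ) ∈ Finset.HasAntidiagonal.antidiagonal n by simp),
      coeff_zero_eq_constantCoeff_apply, h0, Module.End.one_apply] at h1
    rw [eq_sub_of_add_eq h1]
    refine Submodule.sub_mem _ ?_ (Submodule.sum_mem _ fun p hp => hP _ (ih p.2 ?_) _)
    · rw [coeff_one]
      split_ifs
      · simpa using hg
      · simp
    · obtain ⟨hne, hp⟩ := Finset.mem_erase.1 hp
      rw [Finset.HasAntidiagonal.mem_antidiagonal] at hp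
      by_contra hlt
      exact hne (Prod.ext (by simp; omega) (by simp; omega))

/-- The expansion of the Macdonald determinant `D(τu)` over subsets. -/
def macdonaldExpansion (N : ℕ) (τ : RatFun N) : (Op N)⟦X⟧ :=
  ∑ s : Finset (Fin N), monomial s.card (mulOp (τ ^ s.card * macdonaldCoeff s) * Γ s)

/-- The series `G_i`: the Macdonald determinant `D(ut)` in the variables other than `x_i`, expanded
over subsets. -/
def omitExpansion (i : Fin N) : (Op N)⟦X⟧ :=
  ∑ s with i ∉ s, monomial s.card (mulOp (omitCoeff i s) * Γ s)

theorem σ_macdonaldCoeff (i j : Fin N) (s : Finset (Fin N)) :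
    σ i j (macdonaldCoeff s) = macdonaldCoeff (s.map (Equiv.swap i j).toEmbedding) := by
  rw [macdonaldCoeff, σ_tRat_pow_mul_prodA, map_compl_swap, macdonaldCoeff, Finset.card_map]

theorem coeff_macdonaldExpansion_one (n : ℕ) (g : RatFun N) :
    coeff n (macdonaldExpansion N 1) g =
      ∑ s with s.card = n, macdonaldCoeff s * Γ s g := by
  rw [macdonaldExpansion, map_sum, LinearMap.sum_apply, Finset.sum_filter]
  refine Finset.sum_congr rfl fun s _ => ?_
  rw [coeff_monomial, one_pow, one_mul]
  by_cases h : s.card = n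
  · rw [if_pos h.symm, if_pos h]; rfl
  · rw [if_neg (Ne.symm h), if_neg h]; rfl

theorem preservesSym_macdonaldExpansion (N : ℕ) : PreservesSym (macdonaldExpansion N 1) := by
  intro g hg n i j
  rw [coeff_macdonaldExpansion_one, map_sum]
  refine Finset.sum_equiv (Equiv.finsetCongr (Equiv.swap i j)) (fun s => by simp) fun s _ => ?_
  rw [σ_mul, σ_Γ_apply hg, σ_macdonaldCoeff]
  rfl

theorem X_mul_C_mul_monomial (a b : Op N) (k : ℕ) :
    X * (C a * monomial k b) = monomial (k + 1) (a * b) := by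
  rw [← monomial_zero_eq_C_apply, monomial_mul_monomial, X_eq, monomial_mul_monomial, one_mul,
    zero_add, add_comm 1 k]

theorem sum_notMem_insert {M : Type*} [AddCommMonoid M] (i : Fin N) (F : Finset (Fin N) → M) :
    ∑ s with i ∉ s, F (insert i s) = ∑ s with i ∈ s, F s := by
  refine Finset.sum_bij' (fun s _ => insert i s) (fun s _ => s.erase i) ?_ ?_ ?_ ?_ ?_ <;>
    simp +contextual

theorem sum_sum_compl {M : Type*} [AddCommMonoid M] (p : Finset (Fin N))
    (F : Fin N → Finset (Fin N) → M) :
    ∑ s with Disjoint p s, ∑ j ∈ (p ∪ s)ᶜ, F j s =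
      ∑ s with Disjoint p s, ∑ j ∈ s, F j (s.erase j) := by
  rw [Finset.sum_sigma', Finset.sum_sigma']
  refine Finset.sum_bij' (fun a _ => ⟨insert a.2 a.1, a.2⟩) (fun a _ => ⟨a.1.erase a.2, a.2⟩)
    ?_ ?_ ?_ ?_ ?_
  · simp +contextual
  · rintro ⟨s, j⟩ h
    simp only [Finset.mem_sigma, Finset.mem_filter, Finset.mem_univ, true_and,
      Finset.mem_compl, Finset.mem_union, Finset.mem_erase, ne_eq, not_true_eq_false,
      false_and, or_false] at h ⊢
    exact ⟨h.1.mono_right (Finset.erase_subset _ _), fun hj => Finset.disjoint_left.1 h.1 hj h.2⟩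
  · rintro ⟨s, j⟩ h
    simp_all
  · rintro ⟨s, j⟩ h
    simp_all
  · rintro ⟨s, j⟩ h
    simp_all

/-- `(1 + u Z_i) G_i = D(u)` on symmetric functions, where `G_i` is `omitExpansion i`. -/
theorem one_add_Z_mul_omitExpansion (i : Fin N) :
    EqOnSym ((1 + X * C (Z i)) * omitExpansion i) (macdonaldExpansion N 1) := by
  intro g hg
  have hz : ∀ s ∈ Finset.univ.filter (fun s : Finset (Fin N) => i ∉ s),
      evalAt g (X * (C (Z i) * monomial s.card (mulOp (omitCoeff i s) * Γ s))) =
        monomial (insert i s).card (macdonaldCoeff (insert i s) * Γ (insert i s) g) +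
        ∑ j ∈ ({i} ∪ s)ᶜ, monomial (s.card + 1)
          (B i j * (∏ l ∈ Finset.univ.filter (fun l => l ≠ i ∧ l ≠ j), A j l) * omitCoeff j s *
            Γ (insert j s) g) := by
    intro s hs
    have hs' : i ∉ s := (Finset.mem_filter.1 hs).2
    rw [X_mul_C_mul_monomial, evalAt_monomial, Module.End.mul_apply, Module.End.mul_apply,
      mulOp_apply, Z_omitCoeff hs' hg, Finset.card_insert_of_notMem hs', map_add, map_sum]
    rfl
  have hd : Finset.univ.filter (fun s : Finset (Fin N) => i ∉ s) =
      Finset.univ.filter (fun s : Finset (Fin N) => Disjoint {i} s) := by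
    simp
  rw [add_mul, one_mul, map_add, mul_assoc, omitExpansion, Finset.mul_sum, Finset.mul_sum,
    map_sum, map_sum, Finset.sum_congr rfl hz, Finset.sum_add_distrib,
    sum_notMem_insert i fun s => monomial s.card (macdonaldCoeff s * Γ s g), add_left_comm]
  conv_lhs =>
    enter [2, 2]
    rw [hd, sum_sum_compl {i} fun j s => monomial (s.card + 1)
          (B i j * (∏ l ∈ Finset.univ.filter (fun l => l ≠ i ∧ l ≠ j), A j l) * omitCoeff j s *
            Γ (insert j s) g), ← hd]
  rw [← Finset.sum_add_distrib, macdonaldExpansion, map_sum,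
    ← Finset.sum_filter_add_sum_filter_not Finset.univ (fun s : Finset (Fin N) => i ∈ s)]
  refine congrArg₂ _ (Finset.sum_congr rfl fun s _ => ?_) (Finset.sum_congr rfl fun s hs => ?_)
  · rw [evalAt_monomial, one_pow, one_mul]
    rfl
  · have hs' : i ∉ s := (Finset.mem_filter.1 hs).2
    rw [evalAt_monomial, evalAt_monomial, one_pow, one_mul, Module.End.mul_apply,
      Module.End.mul_apply, mulOp_apply, mulOp_apply, ← omitCoeff_add_sum hs', add_mul,
      Finset.sum_mul, map_add, map_sum]
    refine congrArg₂ _ rfl (Finset.sum_congr rfl fun j hj => ?_)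
    rw [Finset.card_erase_add_one hj, Finset.insert_erase hj]

/-- `D(ut) = D(u) + u ∑ U_i G_i`, where `G_i` is `omitExpansion i`. -/
theorem macdonaldExpansion_tRat :
    EqOnSym (macdonaldExpansion N (tRat N))
      (macdonaldExpansion N 1 + X * ∑ i, C (U i) * omitExpansion i) := by
  intro g _
  have hu : evalAt g (X * ∑ i, C (U i) * omitExpansion i) =
      ∑ s : Finset (Fin N), ∑ i ∈ s, monomial s.card
        ((tRat N - 1) * (∏ l ∈ Finset.univ.filter (fun l => l ≠ i), A i l) *
          omitCoeff i (s.erase i) * Γ s g) := by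
    have h1 : ∀ i, evalAt g (X * (C (U i) * omitExpansion i)) =
        ∑ s with i ∉ s, monomial (s.card + 1)
          ((tRat N - 1) * (∏ l ∈ Finset.univ.filter (fun l => l ≠ i), A i l) *
            omitCoeff i s * Γ (insert i s) g) := by
      intro i
      rw [omitExpansion, Finset.mul_sum, Finset.mul_sum, map_sum]
      refine Finset.sum_congr rfl fun s hs => ?_
      rw [X_mul_C_mul_monomial, evalAt_monomial, Module.End.mul_apply, Module.End.mul_apply,
        mulOp_apply, U_omitCoeff (Finset.mem_filter.1 hs).2]
    rw [Finset.mul_sum, map_sum, Finset.sum_congr rfl fun i _ => h1 i]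
    have h2 := sum_sum_compl (∅ : Finset (Fin N)) fun i s => monomial (s.card + 1)
          ((tRat N - 1) * (∏ l ∈ Finset.univ.filter (fun l => l ≠ i), A i l) *
            omitCoeff i s * Γ (insert i s) g)
    simp only [Finset.disjoint_empty_left, Finset.filter_true, Finset.empty_union] at h2
    rw [Finset.sum_comm' (t' := Finset.univ) (s' := fun s => sᶜ) (by simp), h2]
    refine Finset.sum_congr rfl fun s _ => Finset.sum_congr rfl fun i hi => ?_
    rw [Finset.card_erase_add_one hi, Finset.insert_erase hi]
  rw [map_add, hu, macdonaldExpansion, macdonaldExpansion, map_sum, map_sum,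
    ← Finset.sum_add_distrib]
  refine Finset.sum_congr rfl fun s _ => ?_
  rw [evalAt_monomial, evalAt_monomial, ← map_sum, ← map_add, ← Finset.sum_mul, sum_U_coeff]
  simp only [Module.End.mul_apply, mulOp_apply, one_pow]
  congr 1
  ring

theorem EqOnSym.sum {ι : Type*} {s : Finset ι} {P Q : ι → (Op N)⟦X⟧}
    (h : ∀ i ∈ s, EqOnSym (P i) (Q i)) : EqOnSym (∑ i ∈ s, P i) (∑ i ∈ s, Q i) := by
  intro g hg
  rw [map_sum, map_sum]
  exact Finset.sum_congr rfl fun i hi => h i hi g hg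

theorem EqOnSym.trans {P Q R : (Op N)⟦X⟧} (h : EqOnSym P Q) (h' : EqOnSym Q R) : EqOnSym P R :=
  fun g hg => (h g hg).trans (h' g hg)

/-- `D(ut) = (1 + u ∑ U_i (1 + u Z_i)⁻¹) D(u)` on symmetric functions. -/
theorem macdonaldExpansion_tRat_eqOnSym :
    EqOnSym (macdonaldExpansion N (tRat N)) (covariantSeries N * macdonaldExpansion N 1) := by
  refine macdonaldExpansion_tRat.trans fun g hg => ?_
  have h : EqOnSym (∑ i, C (U i) * omitExpansion i)
      ((∑ i, C (U i) * Ring.inverse (1 + X * C (Z i))) * macdonaldExpansion N 1) := by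
    rw [Finset.sum_mul]
    refine EqOnSym.sum fun i _ => ?_
    have h1 := (one_add_Z_mul_omitExpansion i).mul_left (Ring.inverse (1 + X * C (Z i)))
    rw [← mul_assoc, Ring.inverse_mul_cancel _ (isUnit_one_add_X_mul_C_Z i), one_mul] at h1
    rw [mul_assoc]
    exact h1.mul_left _
  rw [covariantSeries, add_mul, one_mul, map_add, map_add, mul_assoc, (h.mul_left X) g hg]

/-! ### Expansion of the Macdonald determinant -/

theorem γ_mul_mulOp (i : Fin N) (h : RatFun N) : γ i * mulOp h = mulOp (γ i h) * γ i := by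
  ext g
  simp only [Module.End.mul_apply, mulOp_apply, γ_mul]

theorem Γ_empty : Γ (∅ : Finset (Fin N)) = 1 := by
  have h : substHom (multiShiftEquiv (∅ : Finset (Fin N))) = AlgHom.id BaseField (RatFun N) := by
    refine RatFun.algHom_ext fun j => ?_
    change Γ ∅ (x j) = x j
    simp [Γ_x]
  ext g
  exact DFunLike.congr_fun h g

theorem γ_prod (i : Fin N) (s : Finset (Fin N)) (f : Fin N → RatFun N) :
    γ i (∏ j ∈ s, f j) = ∏ j ∈ s, γ i (f j) :=
  map_prod (substHom (shiftEquiv i)) f s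

/-- Normal ordering of a product of factors, each a multiplication or a multiple of a shift: a shift
of `x_i` passes through the coefficients attached to the other variables. -/
theorem list_prod_piecewise (s : Finset (Fin N)) (a b : Fin N → RatFun N)
    (ha : ∀ i j, j ≠ i → γ i (a j) = a j) (hb : ∀ i j, j ≠ i → γ i (b j) = b j)
    (l : List (Fin N)) (hl : l.Nodup) :
    (l.map (s.piecewise (fun i => (monomial 1 (mulOp (a i) * γ i) : (Op N)⟦X⟧))
      fun i => monomial 0 (mulOp (b i)))).prod =
      monomial (s ∩ l.toFinset).card
        (mulOp (∏ i ∈ l.toFinset, s.piecewise a b i) * Γ (s ∩ l.toFinset)) := by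
  induction l with
  | nil =>
    have h1 : mulOp (1 : RatFun N) = 1 := by ext; simp [mulOp]
    simp [Γ_empty, h1, monomial_zero_eq_C_apply]
  | cons i l ih =>
    obtain ⟨hi, hl'⟩ := List.nodup_cons.1 hl
    have hi' : i ∉ l.toFinset := by simpa using hi
    rw [List.map_cons, List.prod_cons, ih hl', List.toFinset_cons, Finset.prod_insert hi']
    by_cases his : i ∈ s
    · have hfix : γ i (∏ j ∈ l.toFinset, s.piecewise a b j) =
          ∏ j ∈ l.toFinset, s.piecewise a b j := by
        rw [γ_prod]
        refine Finset.prod_congr rfl fun j hj => ?_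
        have hji : j ≠ i := fun h => hi' (h ▸ hj)
        by_cases hjs : j ∈ s <;> simp [hjs, ha i j hji, hb i j hji]
      rw [Finset.piecewise_eq_of_mem _ _ _ his, Finset.piecewise_eq_of_mem _ _ _ his,
        Finset.inter_insert_of_mem his, Finset.card_insert_of_notMem (by simp [hi]),
        monomial_mul_monomial, add_comm, ← mulOp_mul, ← γ_Γ (by simp [hi]), mul_assoc,
        ← mul_assoc (γ i) (mulOp _), γ_mul_mulOp, hfix]
      simp only [mul_assoc]
    · rw [Finset.piecewise_eq_of_notMem _ _ _ his, Finset.piecewise_eq_of_notMem _ _ _ his,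
        Finset.inter_insert_of_notMem his, monomial_mul_monomial, zero_add, ← mul_assoc, mulOp_mul]

theorem ofFn_prod_add (a b : Fin N → RatFun N)
    (ha : ∀ i j, j ≠ i → γ i (a j) = a j) (hb : ∀ i j, j ≠ i → γ i (b j) = b j) :
    (List.ofFn fun i => (monomial 1 (mulOp (a i) * γ i) + monomial 0 (mulOp (b i)) :
      (Op N)⟦X⟧)).prod =
      ∑ s : Finset (Fin N), monomial s.card (mulOp (∏ i, s.piecewise a b i) * Γ s) := by
  have h := (MultilinearMap.mkPiAlgebraFin ℤ N (Op N)⟦X⟧).map_add_univ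
    (fun i => monomial 1 (mulOp (a i) * γ i)) (fun i => monomial 0 (mulOp (b i)))
  simp only [MultilinearMap.mkPiAlgebraFin_apply] at h
  refine h.trans (Finset.sum_congr rfl fun s _ => ?_)
  have hu : (List.finRange N).toFinset = Finset.univ := by ext; simp
  rw [List.ofFn_eq_map, list_prod_piecewise s a b ha hb _ (List.nodup_finRange N), hu,
    Finset.inter_univ]

/-- The number of increasing pairs in `s`. -/
theorem sum_Ioi_card (s : Finset (Fin N)) :
    ∑ i, ∑ j ∈ Finset.Ioi i, (if i ∈ s ∧ j ∈ s then 1 else 0) = s.card.choose 2 := by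
  have h := Finset.sum_sum_Ioi_add_eq_sum_sum_off_diag
    (fun j i : Fin N => if i ∈ s ∧ j ∈ s then 1 else 0)
  have h1 : ∀ i, ∑ j ∈ ({i} : Finset (Fin N))ᶜ, (if i ∈ s ∧ j ∈ s then 1 else 0) =
      if i ∈ s then s.card - 1 else 0 := by
    intro i
    by_cases hi : i ∈ s
    · rw [if_pos hi, ← Finset.card_erase_of_mem hi, ← Finset.sum_filter, ← Finset.card_eq_sum_ones]
      congr 1
      ext j
      simp [hi]
    · simp [hi]
  rw [Finset.sum_congr rfl fun i _ => h1 i, ← Finset.sum_filter, Finset.sum_const,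
    Finset.filter_univ_mem, smul_eq_mul] at h
  have h2 : ∑ i, ∑ j ∈ Finset.Ioi i,
      ((if i ∈ s ∧ j ∈ s then 1 else 0) + if j ∈ s ∧ i ∈ s then 1 else 0) =
      (∑ i, ∑ j ∈ Finset.Ioi i, (if i ∈ s ∧ j ∈ s then 1 else 0)) * 2 := by
    simp only [Finset.sum_mul]
    refine Finset.sum_congr rfl fun i _ => Finset.sum_congr rfl fun j _ => ?_
    by_cases hi : i ∈ s <;> by_cases hj : j ∈ s <;> simp [hi, hj]
  rw [h2] at h
  rw [Nat.choose_two_right, ← h, Nat.mul_div_cancel _ two_pos]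

/-- The ratio of the Vandermonde determinant with `x_i` replaced by `x_i / t` for `i ∈ s`, its
denominators cleared, to the original one. -/
theorem det_shifted_vandermonde (s : Finset (Fin N)) :
    (Matrix.of fun i j : Fin N =>
      x i ^ (N - 1 - (j : ℕ)) * (if i ∈ s then tRat N else 1) ^ (j : ℕ)).det =
      vandermonde N * macdonaldCoeff s := by
  have hproj : ∀ c : Fin N → RatFun N,
      (Matrix.of fun i j : Fin N => x i ^ (N - 1 - (j : ℕ)) * c i ^ (j : ℕ)).det =
      ∏ i : Fin N, ∏ j ∈ Finset.Ioi i, (c j * x i - c i * x j) := by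
    intro c
    rw [← Matrix.det_projVandermonde]
    congr 1
    ext i j
    rw [Matrix.projVandermonde_apply, Matrix.of_apply, Fin.val_rev, mul_comm]
    congr 2
    omega
  have hv : vandermonde N = ∏ i : Fin N, ∏ j ∈ Finset.Ioi i, (x i - x j) := by
    have := hproj fun _ => 1
    simpa [vandermonde] using this
  -- The ratio of the two factors of a pair is symmetric in the pair: a power of `t` times
  -- off-diagonal factors `G`, of which only the one with `a ∈ s`, `b ∉ s` is not `1`.
  set G : Fin N → Fin N → RatFun N := fun b a => if a ∈ s ∧ b ∉ s then A a b else 1 with hG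
  have hpair : ∀ i j : Fin N, i ≠ j →
      (if j ∈ s then tRat N else 1) * x i - (if i ∈ s then tRat N else 1) * x j =
      (x i - x j) * (tRat N ^ (if i ∈ s ∧ j ∈ s then 1 else 0) * (G j i * G i j)) := by
    intro i j hij
    have h1 := x_sub_ne_zero hij
    have h2 := x_sub_ne_zero hij.symm
    by_cases hi : i ∈ s <;> by_cases hj : j ∈ s <;> simp only [hG, hi, hj, A] <;> simp
    · ring
    · field_simp
    · field_simp
      ring
  have hprodA : prodA s sᶜ = ∏ i, ∏ j ∈ ({i} : Finset (Fin N))ᶜ, G j i := by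
    rw [prodA, ← Finset.prod_subset (Finset.subset_univ s)]
    · refine Finset.prod_congr rfl fun i hi => ?_
      have hsub : sᶜ ⊆ ({i} : Finset (Fin N))ᶜ := by simpa using hi
      rw [← Finset.prod_subset hsub]
      · exact Finset.prod_congr rfl fun j hj => by simp [hG, hi, Finset.mem_compl.1 hj]
      · intro j _ hj
        simp only [Finset.mem_compl, not_not] at hj
        simp [hG, hj]
    · intro i _ hi
      exact Finset.prod_eq_one fun j _ => by simp [hG, hi]
  rw [hproj, hv, macdonaldCoeff, hprodA, ← Finset.prod_prod_Ioi_mul_eq_prod_prod_off_diag,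
    ← sum_Ioi_card, ← Finset.prod_pow_eq_pow_sum]
  simp only [← Finset.prod_pow_eq_pow_sum, ← Finset.prod_mul_distrib]
  exact Finset.prod_congr rfl fun i _ => Finset.prod_congr rfl fun j hj =>
    hpair i j (Finset.mem_Ioi.1 hj).ne

theorem γ_pow_mul (i j : Fin N) (h : j ≠ i) (c : BaseField) (k : ℕ) :
    γ i (algebraMap BaseField (RatFun N) c * x j ^ k) =
      algebraMap BaseField (RatFun N) c * x j ^ k := by
  have h1 := γ_x_of_ne h
  simp only [γ, substOp_apply] at h1 ⊢
  rw [map_mul, map_pow, h1, AlgHom.commutes]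

/-- The Macdonald determinant `D(cu)`, expanded over the set of rows in which the shift is taken. -/
theorem macdonaldD_smul_X (c : BaseField) :
    macdonaldD N (c • X) = macdonaldExpansion N (algebraMap BaseField (RatFun N) c) := by
  set τ := algebraMap BaseField (RatFun N) c with hτ
  have hfactor : ∀ (i : Fin N) (e k : ℕ),
      C (mulOp (x i ^ e)) * (1 + c • X * C (mulOp (tRat N ^ k) * γ i)) =
      (monomial 1 (mulOp (τ * tRat N ^ k * x i ^ e) * γ i) + monomial 0 (mulOp (x i ^ e)) :
        (Op N)⟦X⟧) := by
    intro i e k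
    have h2 : mulOp (τ * tRat N ^ k * x i ^ e) * γ i =
        c • (mulOp (x i ^ e) * (mulOp (tRat N ^ k) * γ i)) := by
      ext g
      simp only [Module.End.mul_apply, mulOp_apply, LinearMap.smul_apply]
      rw [Algebra.smul_def, ← hτ]
      ring
    rw [mul_add, mul_one, add_comm, h2, smul_mul_assoc, mul_smul_comm, ← monomial_zero_eq_C_apply,
      ← monomial_zero_eq_C_apply, X_eq, monomial_mul_monomial, monomial_mul_monomial, one_mul]
    simp
  have hprod : ∀ p : Equiv.Perm (Fin N),
      (List.ofFn fun i : Fin N =>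
        C (mulOp (x i ^ (N - 1 - (p i : ℕ)))) *
          (1 + c • X * C (mulOp (tRat N ^ (p i : ℕ)) * γ i))).prod =
      ∑ s : Finset (Fin N), monomial s.card
        (mulOp (τ ^ s.card * ∏ i, (x i ^ (N - 1 - (p i : ℕ)) *
          (if i ∈ s then tRat N else 1) ^ (p i : ℕ))) * Γ s) := by
    intro p
    simp only [hfactor]
    rw [ofFn_prod_add (fun i => τ * tRat N ^ (p i : ℕ) * x i ^ (N - 1 - (p i : ℕ)))
      (fun i => x i ^ (N - 1 - (p i : ℕ)))]
    · refine Finset.sum_congr rfl fun s _ => ?_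
      have hs : τ ^ s.card = ∏ i, if i ∈ s then τ else 1 := by
        rw [Finset.prod_ite_mem, Finset.univ_inter, Finset.prod_const]
      rw [hs, ← Finset.prod_mul_distrib]
      congr 3
      refine Finset.prod_congr rfl fun i _ => ?_
      by_cases hi : i ∈ s
      · simp [hi]
        ring
      · simp [hi]
    · intro i j hji
      have := γ_pow_mul i j hji (c * t ^ (p j : ℕ)) (N - 1 - (p j : ℕ))
      rwa [RingHom.map_mul, RingHom.map_pow] at this
    · intro i j hji
      have := γ_pow_mul i j hji 1 (N - 1 - (p j : ℕ))
      rwa [map_one, one_mul] at this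
  have hint : ∀ (k : ℤ) (m : ℕ) (a : Op N),
      (k : (Op N)⟦X⟧) * monomial m a = monomial m (k • a) := fun k m a => by
    rw [map_zsmul, zsmul_eq_mul]
  rw [macdonaldD]
  simp only [hprod, zsmul_eq_mul, Finset.mul_sum (s := (Finset.univ : Finset (Finset (Fin N))))]
  rw [Finset.sum_comm, Finset.mul_sum, macdonaldExpansion]
  refine Finset.sum_congr rfl fun s _ => ?_
  have hdet := det_shifted_vandermonde s
  rw [← Matrix.det_transpose, Matrix.det_apply'] at hdet
  simp only [hint, ← map_sum]
  rw [← monomial_zero_eq_C_apply, monomial_mul_monomial, zero_add]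
  congr 1
  ext g
  have hne := vandermonde_ne_zero N
  have hcoeff : macdonaldCoeff s = (vandermonde N)⁻¹ * (vandermonde N * macdonaldCoeff s) := by
    rw [inv_mul_cancel_left₀ hne]
  rw [hcoeff, ← hdet]
  simp only [Module.End.mul_apply, mulOp_apply, LinearMap.sum_apply, LinearMap.smul_apply]
  simp only [zsmul_eq_mul, Matrix.transpose_apply, Matrix.of_apply, Finset.mul_sum,
    Finset.sum_mul]
  refine Finset.sum_congr rfl fun p _ => ?_
  ring

theorem algebraMap_mem_symRatFun (f : MvPolynomial (Fin N) BaseField) (hf : f.IsSymmetric) :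
    algebraMap (Poly N) (RatFun N) f ∈ symRatFun N := by
  intro i j
  simp only [σ, substOp, AlgEquiv.toLinearMap_apply, IsFractionRing.algEquivOfAlgEquiv_algebraMap]
  exact congrArg _ (hf (Equiv.swap i j))

end

end CovariantMacdonald

open CovariantMacdonald in
theorem theorem2p5 (N : ℕ) (f : MvPolynomial (Fin N) BaseField) (hf : f.IsSymmetric) (n : ℕ) :
    PowerSeries.coeff n (macdonaldRatio N) (algebraMap (Poly N) (RatFun N) f) =
      PowerSeries.coeff n (covariantSeries N) (algebraMap (Poly N) (RatFun N) f) := by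
  have hX : macdonaldD N PowerSeries.X = macdonaldExpansion N 1 := by
    simpa using macdonaldD_smul_X (N := N) 1
  have hunit := isUnit_macdonaldD N
  have hinv : PreservesSym (Ring.inverse (macdonaldD N PowerSeries.X)) :=
    (hX ▸ preservesSym_macdonaldExpansion N).of_mul_eq_one
      (constantCoeff_macdonaldD (by simp)) (Ring.mul_inverse_cancel _ hunit)
  have h := (macdonaldExpansion_tRat_eqOnSym (N := N)).mul_right hinv
  rw [tRat, ← macdonaldD_smul_X, ← hX, mul_assoc, Ring.mul_inverse_cancel _ hunit, mul_one] at h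
  exact h.coeff_eq (algebraMap_mem_symRatFun f hf) n
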